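/- Let $K_n^{(m)}$ denote the complete $m$-partite graph with $n$ vertices in each part ($n,m\ge 1$). In the hat guessing game on a graph $G$ with color set $Q$, each vertex $v$ receives a hat with a color $x_v\in Q$ and has to guess its own color as a function, fixed in advance, of the colors of its neighbors in $G$ only; the strategy (the collection of all these guessing functions) is winning if for every coloring $x\in Q^{V(G)}$ at least one vertex guesses its own color correctly. When $Q=F$ is a field, the strategy is called linear if each guessing function is an affine function over $F$ of the colors of the neighbors. There is an absolute constant $c>0$ such that for all integers $n,m\ge 1$ and every field $F$ with at least $(c\log(nm))^m$ elements, no linear guessing strategy for $K_n^{(m)}$ over $F$ is winning; that is, for every linear strategy there is a coloring of the vertices by elements of $F$ for which every vertex guesses wrong. -/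

import Mathlib

/-- A guessing strategy for the hat guessing game on the graph `G` with color set `Q`: each vertex
`v` has a guessing function, which takes the hat colors of the neighbors of `v` in `G` and returns
the guess of `v`. -/
def HatStrategy {V : Type*} (G : SimpleGraph V) (Q : Type*) :=
  (v : V) → (G.neighborSet v → Q) → Q

/-- A strategy is winning if for every assignment of hat colors at least one vertex guesses its
own color correctly. -/
def HatStrategy.IsWinning {V : Type*} {G : SimpleGraph V} {Q : Type*} (S : HatStrategy G Q) :
    Prop :=
  ∀ x : V → Q, ∃ v : V, S v (fun u => x u) = x v

/-- A strategy whose colors are the elements of a field is linear if every vertex guesses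
according to an affine function of the colors of its neighbors. -/
def HatStrategy.IsLinear {V : Type*} {G : SimpleGraph V} {F : Type*} [Field F]
    (S : HatStrategy G F) : Prop :=
  ∀ v : V, ∃ A : (G.neighborSet v → F) →ᵃ[F] F, ∀ y : G.neighborSet v → F, S v y = A y

/-! Write the guesses as `f v x + b v` and attach to each `x` the set of points `(v, x v - f v x)`.
By linearity `x - y` beats the strategy as soon as the set of `x` avoids the set of `y` shifted by
`b`. Over a finite field with `q` elements these sets are spread: among the points of `T`, a
fraction at least `1 / m` lies over one part, where the forms are independent, so the proportion of
`x` whose set contains `T` is at most `q ^ (-|T| / m)`. The spread lemma (`card_misses_le`), proved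
through minimal fragments, shows that a random set of density at most 1/2 contains a member with
probability at least 2/3. Two such random sets can be coupled to be disjoint up to the shift, and
with positive probability both contain members (`exists_disjoint_of_spread`). Infinite fields need
only a line-avoidance argument. -/

/-! ### Spread families and minimal fragments -/

/-- The set `T` is contained in at most an `N * κ⁻¹ ^ |T|` of the members of a family, for all `T`. -/
def SpreadFamily {X ι : Type*} [DecidableEq X] (Ω : Finset ι) (S : ι → Finset X) (N κ : ℝ) : Prop :=
  ∀ T : Finset X, ((Ω.filter fun ω => T ⊆ S ω).card : ℝ) ≤ N * κ⁻¹ ^ T.card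

/-- The set of points that receive color `0`. -/
def zeroClass {X : Type*} [Fintype X] {L : ℕ} [NeZero L] (w : X → Fin L) : Finset X :=
  Finset.univ.filter fun x => w x = 0

/-- Recolor the points of `T` with `0`. -/
def recolor {X : Type*} [DecidableEq X] {L : ℕ} [NeZero L] (T : Finset X) (w : X → Fin L) :
    X → Fin L :=
  fun x => if x ∈ T then 0 else w x

lemma zeroClass_recolor {X : Type*} [Fintype X] [DecidableEq X] {L : ℕ} [NeZero L]
    (T : Finset X) (w : X → Fin L) : zeroClass (recolor T w) = zeroClass w ∪ T := by
  ext x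
  by_cases hx : x ∈ T <;> simp [zeroClass, recolor, hx]

/-- Every member of a family has a minimal fragment outside `W`. -/
lemma exists_fragment {X ι : Type*} [DecidableEq X] (Ω : Finset ι) (S : ι → Finset X)
    (W : Finset X) (ω : ι) (hω : ω ∈ Ω) :
    ∃ T, T ⊆ S ω ∧ (∃ ω' ∈ Ω, S ω' ⊆ W ∪ T) ∧ ∀ ω' ∈ Ω, S ω' ⊆ W ∪ T → T ⊆ S ω' := by
  classical
  -- The fragment is the smallest remainder outside `W` among members inside `W ∪ S ω`.
  obtain ⟨ω₀, h₀, hmin⟩ := Finset.exists_min_image (Ω.filter fun ω' => S ω' ⊆ W ∪ S ω)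
    (fun ω' => (S ω' \ W).card) ⟨ω, by simp [hω]⟩
  rw [Finset.mem_filter] at h₀
  have hT : S ω₀ \ W ⊆ S ω := by
    intro x hx
    have := h₀.2 (Finset.mem_sdiff.1 hx).1
    grind
  refine ⟨S ω₀ \ W, hT, ⟨ω₀, h₀.1, by simp⟩, fun ω' hω' h => ?_⟩
  have h1 : S ω' \ W ⊆ S ω₀ \ W := by
    intro x hx
    have := h (Finset.mem_sdiff.1 hx).1
    grind
  have h2 := hmin ω' (by
    rw [Finset.mem_filter]
    exact ⟨hω', h.trans (Finset.union_subset_union_right hT)⟩)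
  rw [← Finset.eq_of_subset_of_card_le h1 h2]
  exact Finset.sdiff_subset

/-- Recoloring forgets only the colors on `T`, so its fibers have at most `L ^ |T|` elements. -/
lemma card_filter_recolor_le {X : Type*} [Fintype X] [DecidableEq X] {L : ℕ} [NeZero L]
    (T : Finset X) (P : (X → Fin L) → Prop) [DecidablePred P] :
    (Finset.univ.filter fun w => P (recolor T w)).card ≤
      L ^ T.card * (Finset.univ.filter P).card := by
  have h : (Finset.univ.filter fun w => P (recolor T w)).card ≤
      ((Finset.univ : Finset (T → Fin L)) ×ˢ (Finset.univ.filter P)).card := by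
    refine Finset.card_le_card_of_injOn (fun w => (fun x => w x, recolor T w)) ?_ ?_
    · intro w hw
      simpa using hw
    · intro w _ w' _ h
      simp only [Prod.mk.injEq] at h
      funext x
      by_cases hx : x ∈ T
      · exact congrFun h.1 ⟨x, hx⟩
      · simpa [recolor, hx] using congrFun h.2 x
  simpa using h

/-- On average over all colorings, few members of a spread family have a large fragment outside
the zero class. -/
lemma sum_card_large_fragment_le {X ι : Type*} [Fintype X] [DecidableEq X] {L : ℕ} [NeZero L]
    {Ω : Finset ι} {S : ι → Finset X} {N κ : ℝ} (hN : 0 ≤ N) (hκ : 0 < κ) (hL : (L : ℝ) ≤ κ)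
    (hS : SpreadFamily Ω S N κ) {k h : ℕ} (hk : ∀ ω ∈ Ω, (S ω).card ≤ k)
    (τ : (X → Fin L) → ι → Finset X) (hτ : ∀ w, ∀ ω ∈ Ω, τ w ω ⊆ S ω)
    (hτ' : ∀ w, ∀ ω ∈ Ω, ∃ ω' ∈ Ω, S ω' ⊆ zeroClass w ∪ τ w ω)
    (hmin : ∀ w, ∀ ω ∈ Ω, ∀ ω' ∈ Ω, S ω' ⊆ zeroClass w ∪ τ w ω → τ w ω ⊆ S ω') :
    ∑ w : X → Fin L, ((Ω.filter fun ω => h ≤ (τ w ω).card).card : ℝ) ≤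
      (L : ℝ) ^ Fintype.card X * (N * (2 ^ k * (L / κ) ^ h)) := by
  classical
  -- `σ w'` depends on `w'` alone. Minimality puts the fragment inside `σ` of the recolored `w`,
  -- which leaves at most `2 ^ k` candidates for it.
  have hσ : ∀ w' : X → Fin L, ∃ s : Finset X, s.card ≤ k ∧
      ((∃ ω ∈ Ω, S ω ⊆ zeroClass w') → ∃ ω ∈ Ω, S ω ⊆ zeroClass w' ∧ s = S ω) := by
    intro w'
    by_cases hw : ∃ ω ∈ Ω, S ω ⊆ zeroClass w'
    · obtain ⟨ω, h1, h2⟩ := hw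
      exact ⟨S ω, hk ω h1, fun _ => ⟨ω, h1, h2, rfl⟩⟩
    · exact ⟨∅, by simp, fun h => absurd h hw⟩
  choose σ hσk hσ using hσ
  have hsub : ∀ w, ∀ ω ∈ Ω, τ w ω ⊆ σ (recolor (τ w ω) w) := by
    intro w ω hω
    obtain ⟨ω₁, h1, h2, h3⟩ := hσ (recolor (τ w ω) w) (by
      rw [zeroClass_recolor]; exact hτ' w ω hω)
    rw [h3]
    rw [zeroClass_recolor] at h2
    exact hmin w ω hω ω₁ h1 h2
  have hρ0 : 0 ≤ (L : ℝ) / κ := by positivity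
  have hρ1 : (L : ℝ) / κ ≤ 1 := (div_le_one hκ).2 hL
  set big : Finset (Finset X) := Finset.univ.filter fun T => h ≤ T.card with hbig
  have step1 : ∀ w : X → Fin L, ((Ω.filter fun ω => h ≤ (τ w ω).card).card : ℝ) ≤
      ∑ T ∈ big, if T ⊆ σ (recolor T w) then N * κ⁻¹ ^ T.card else 0 := by
    intro w
    have h1 : (Ω.filter fun ω => h ≤ (τ w ω).card) ⊆
        (big.filter fun T => T ⊆ σ (recolor T w)).biUnion
          fun T => Ω.filter fun ω => T ⊆ S ω := by
      intro ω hω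
      rw [Finset.mem_filter] at hω
      simp only [Finset.mem_biUnion, Finset.mem_filter, hbig, Finset.mem_univ, true_and]
      exact ⟨τ w ω, ⟨hω.2, hsub w ω hω.1⟩, hω.1, hτ w ω hω.1⟩
    have h2 := (Finset.card_le_card h1).trans Finset.card_biUnion_le
    rw [← Finset.sum_filter]
    calc ((Ω.filter fun ω => h ≤ (τ w ω).card).card : ℝ)
        ≤ ∑ T ∈ big.filter (fun T => T ⊆ σ (recolor T w)),
            ((Ω.filter fun ω => T ⊆ S ω).card : ℝ) := by exact_mod_cast h2
      _ ≤ _ := Finset.sum_le_sum fun T _ => hS T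
  -- The factor `L ^ |T|` lost by recoloring is absorbed by the spread factor `κ⁻¹ ^ |T|`.
  have step2 : ∀ T ∈ big, (∑ w : X → Fin L,
      if T ⊆ σ (recolor T w) then N * κ⁻¹ ^ T.card else 0) ≤
      ∑ w : X → Fin L, if T ⊆ σ w then N * (L / κ) ^ T.card else 0 := by
    intro T _
    rw [← Finset.sum_filter, ← Finset.sum_filter, Finset.sum_const, Finset.sum_const,
      nsmul_eq_mul, nsmul_eq_mul]
    have h3 : ((Finset.univ.filter fun w : X → Fin L => T ⊆ σ (recolor T w)).card : ℝ) ≤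
        (L : ℝ) ^ T.card * (Finset.univ.filter fun w : X → Fin L => T ⊆ σ w).card := by
      exact_mod_cast card_filter_recolor_le T fun w => T ⊆ σ w
    calc _ ≤ ((L : ℝ) ^ T.card * (Finset.univ.filter fun w : X → Fin L => T ⊆ σ w).card) *
          (N * κ⁻¹ ^ T.card) := by gcongr
      _ = _ := by rw [div_eq_mul_inv, mul_pow]; ring
  have step3 : ∀ w : X → Fin L,
      (∑ T ∈ big, if T ⊆ σ w then N * ((L : ℝ) / κ) ^ T.card else 0) ≤
        N * (2 ^ k * (L / κ) ^ h) := by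
    intro w
    rw [← Finset.sum_filter]
    have h4 : (big.filter fun T => T ⊆ σ w) ⊆ (σ w).powerset := by
      intro T hT
      exact Finset.mem_powerset.2 (Finset.mem_filter.1 hT).2
    have h5 : (((big.filter fun T => T ⊆ σ w).card : ℕ) : ℝ) ≤ 2 ^ k := by
      have := Finset.card_le_card h4
      rw [Finset.card_powerset] at this
      exact_mod_cast this.trans (Nat.pow_le_pow_right (by norm_num) (hσk w))
    calc _ ≤ ∑ T ∈ big.filter (fun T => T ⊆ σ w), N * ((L : ℝ) / κ) ^ h := by
          refine Finset.sum_le_sum fun T hT => ?_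
          have : h ≤ T.card := by simp [hbig] at hT; exact hT.1
          exact mul_le_mul_of_nonneg_left (pow_le_pow_of_le_one hρ0 hρ1 this) hN
      _ = (big.filter fun T => T ⊆ σ w).card * (N * ((L : ℝ) / κ) ^ h) := by
          rw [Finset.sum_const, nsmul_eq_mul]
      _ ≤ 2 ^ k * (N * ((L : ℝ) / κ) ^ h) := by gcongr
      _ = _ := by ring
  calc _ ≤ ∑ w : X → Fin L, ∑ T ∈ big,
        if T ⊆ σ (recolor T w) then N * κ⁻¹ ^ T.card else 0 :=
        Finset.sum_le_sum fun w _ => step1 w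
    _ = ∑ T ∈ big, ∑ w : X → Fin L,
        if T ⊆ σ (recolor T w) then N * κ⁻¹ ^ T.card else 0 := Finset.sum_comm
    _ ≤ ∑ T ∈ big, ∑ w : X → Fin L, if T ⊆ σ w then N * ((L : ℝ) / κ) ^ T.card else 0 :=
        Finset.sum_le_sum step2
    _ = ∑ w : X → Fin L, ∑ T ∈ big, if T ⊆ σ w then N * ((L : ℝ) / κ) ^ T.card else 0 :=
        Finset.sum_comm
    _ ≤ ∑ _w : X → Fin L, N * (2 ^ k * (L / κ) ^ h) := Finset.sum_le_sum fun w _ => step3 w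
    _ = _ := by simp

/-! ### The spread lemma -/

/-- No member of the family lies in the union of the zero classes of the colorings `W`. -/
def Misses {X ι : Type*} (Ω : Finset ι) (S : ι → Finset X) {R L : ℕ} [NeZero L]
    (W : Fin R → X → Fin L) : Prop :=
  ∀ ω ∈ Ω, ∃ x ∈ S ω, ∀ j, W j x ≠ 0

/-- The spread lemma: if the members of a `κ`-spread family have less than `2 ^ R` elements, then
the union of `R` random sets of density `1 / L ≥ 16 / κ` likely contains one of them. -/
lemma card_misses_le {X ι : Type*} [Fintype X] [DecidableEq X] {L : ℕ} [NeZero L]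
    {N κ : ℝ} (hN : 0 ≤ N) (hκ : 0 < κ) (hL : 16 * (L : ℝ) ≤ κ) (R : ℕ) :
    ∀ (Ω : Finset ι) (S : ι → Finset X), SpreadFamily Ω S N κ →
      (∀ ω ∈ Ω, (S ω).card < 2 ^ R) →
      (Ω.card : ℝ) * (Nat.card {W : Fin R → X → Fin L // Misses Ω S W} : ℝ) ≤
        N * ((1 - (1 / 4) ^ R) / 3) * ((L : ℝ) ^ Fintype.card X) ^ R := by
  classical
  induction R with
  | zero =>
    intro Ω S _ hk
    rcases Ω.eq_empty_or_nonempty with rfl | ⟨ω, hω⟩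
    · simp
    · have : IsEmpty {W : Fin 0 → X → Fin L // Misses Ω S W} := by
        refine ⟨fun W => ?_⟩
        obtain ⟨x, hx, _⟩ := W.2 ω hω
        have := hk ω hω
        simp only [pow_zero, Nat.lt_one_iff, Finset.card_eq_zero] at this
        simp [this] at hx
      simp
  | succ R ih =>
    intro Ω S hS hk
    have hfr : ∀ (w : X → Fin L) (ω : ι), ∃ T, ω ∈ Ω → (T ⊆ S ω ∧
        (∃ ω' ∈ Ω, S ω' ⊆ zeroClass w ∪ T) ∧
          ∀ ω' ∈ Ω, S ω' ⊆ zeroClass w ∪ T → T ⊆ S ω') := by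
      intro w ω
      by_cases hω : ω ∈ Ω
      · obtain ⟨T, hT⟩ := exists_fragment Ω S (zeroClass w) ω hω
        exact ⟨T, fun _ => hT⟩
      · exact ⟨∅, fun h => absurd h hω⟩
    choose τ hτ using hfr
    have hL' : (L : ℝ) ≤ κ := by
      have : (0 : ℝ) ≤ L := by positivity
      linarith
    have hbad := sum_card_large_fragment_le (h := 2 ^ R) hN hκ hL' hS
      (k := 2 * 2 ^ R) (fun ω hω => by have := hk ω hω; rw [pow_succ] at this; omega) τ
      (fun w ω hω => (hτ w ω hω).1) (fun w ω hω => (hτ w ω hω).2.1)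
      (fun w ω hω => (hτ w ω hω).2.2)
    -- The constant 16 gives `4 ^ (2 ^ R) / 16 ^ (2 ^ R)`. These losses sum to `(1 - (1 / 4) ^ R) /
    -- 3`.
    have hsmall : (2 : ℝ) ^ (2 * 2 ^ R) * (L / κ) ^ (2 ^ R) ≤ (1 / 4) ^ (R + 1) := by
      have h1 : (L : ℝ) / κ ≤ 1 / 16 := by rw [div_le_div_iff₀ hκ (by norm_num)]; linarith
      calc (2 : ℝ) ^ (2 * 2 ^ R) * (L / κ) ^ (2 ^ R)
          ≤ (2 : ℝ) ^ (2 * 2 ^ R) * (1 / 16) ^ (2 ^ R) := by gcongr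
        _ = (1 / 4) ^ (2 ^ R) := by rw [pow_mul, ← mul_pow]; norm_num
        _ ≤ (1 / 4) ^ (R + 1) :=
          pow_le_pow_of_le_one (by norm_num) (by norm_num) Nat.lt_two_pow_self
    set P : ℝ := (L : ℝ) ^ Fintype.card X with hP
    have hP0 : 0 ≤ P := by positivity
    have hcard : (Nat.card {W : Fin (R + 1) → X → Fin L // Misses Ω S W} : ℝ) =
        ∑ w : X → Fin L,
          (Nat.card {W : Fin R → X → Fin L // Misses Ω S (Fin.cons w W : Fin (R + 1) → X → Fin L)} : ℝ) := by
      rw [← Nat.cast_sum, ← Nat.card_sigma]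
      congr 1
      refine Nat.card_congr ?_
      exact
        { toFun := fun W => ⟨W.1 0, Fin.tail W.1, by rw [Fin.cons_self_tail]; exact W.2⟩
          invFun := fun W => ⟨Fin.cons W.1 W.2.1, W.2.2⟩
          left_inv := fun W => Subtype.ext (Fin.cons_self_tail W.1)
          right_inv := fun W => rfl }
    have hstep : ∀ w : X → Fin L, (Ω.card : ℝ) *
        (Nat.card {W : Fin R → X → Fin L // Misses Ω S (Fin.cons w W : Fin (R + 1) → X → Fin L)} : ℝ)
        ≤ N * ((1 - (1 / 4) ^ R) / 3) * P ^ R +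
          ((Ω.filter fun ω => 2 ^ R ≤ (τ w ω).card).card : ℝ) * P ^ R := by
      intro w
      set good := Ω.filter fun ω => ¬ 2 ^ R ≤ (τ w ω).card with hgood
      -- Fragments inherit the spread bound with the same `N`, although the family shrinks.
      have hih := ih good (τ w) (by
          intro T
          refine le_trans ?_ (hS T)
          norm_cast
          refine Finset.card_le_card fun ω hω => ?_
          simp only [Finset.mem_filter, hgood] at hω ⊢
          exact ⟨hω.1.1, hω.2.trans (hτ w ω hω.1.1).1⟩) (by
          intro ω hω
          simp only [Finset.mem_filter, hgood, not_le] at hω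
          exact hω.2)
      have hle1 : (Nat.card {W : Fin R → X → Fin L //
          Misses Ω S (Fin.cons w W : Fin (R + 1) → X → Fin L)} : ℝ) ≤
          (Nat.card {W : Fin R → X → Fin L // Misses good (τ w) W} : ℝ) := by
        norm_cast
        refine Nat.card_le_card_of_injective (fun W => ⟨W.1, ?_⟩) ?_
        · intro ω hω
          have hωΩ := (Finset.mem_filter.1 hω).1
          obtain ⟨ω', h1, h2⟩ := (hτ w ω hωΩ).2.1
          obtain ⟨x, hx, hx'⟩ := W.2 ω' h1
          refine ⟨x, ?_, fun j => by simpa using hx' j.succ⟩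
          rcases Finset.mem_union.1 (h2 hx) with h3 | h3
          · exact absurd (by simpa [zeroClass] using h3) (hx' 0)
          · exact h3
        · intro W W' h
          simpa [Subtype.ext_iff] using h
      have hle2 : (Nat.card {W : Fin R → X → Fin L //
          Misses Ω S (Fin.cons w W : Fin (R + 1) → X → Fin L)} : ℝ) ≤ P ^ R := by
        have := Finite.card_subtype_le (fun W : Fin R → X → Fin L =>
          Misses Ω S (Fin.cons w W : Fin (R + 1) → X → Fin L))
        have h2 : Nat.card (Fin R → X → Fin L) = (L ^ Fintype.card X) ^ R := by simp
        rw [h2] at this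
        rw [hP]
        exact_mod_cast this
      have hsplit : (Ω.card : ℝ) =
          ((Ω.filter fun ω => 2 ^ R ≤ (τ w ω).card).card : ℝ) + good.card := by
        norm_cast
        exact (Finset.card_filter_add_card_filter_not _).symm
      rw [hsplit, add_mul]
      have h1 := mul_le_mul_of_nonneg_left hle1 (Nat.cast_nonneg (α := ℝ) good.card)
      have h2 := mul_le_mul_of_nonneg_left hle2
        (Nat.cast_nonneg (α := ℝ) (Ω.filter fun ω => 2 ^ R ≤ (τ w ω).card).card)
      linarith
    rw [hcard, Finset.mul_sum]
    calc _ ≤ ∑ w : X → Fin L, (N * ((1 - (1 / 4) ^ R) / 3) * P ^ R +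
          ((Ω.filter fun ω => 2 ^ R ≤ (τ w ω).card).card : ℝ) * P ^ R) :=
          Finset.sum_le_sum fun w _ => hstep w
      _ = P * (N * ((1 - (1 / 4) ^ R) / 3) * P ^ R) +
          (∑ w : X → Fin L, ((Ω.filter fun ω => 2 ^ R ≤ (τ w ω).card).card : ℝ)) * P ^ R := by
          rw [Finset.sum_add_distrib, Finset.sum_mul]
          simp [hP]
      _ ≤ P * (N * ((1 - (1 / 4) ^ R) / 3) * P ^ R) + (P * (N * (1 / 4) ^ (R + 1))) * P ^ R := by
          gcongr
          refine hbad.trans ?_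
          gcongr
      _ = _ := by ring

/-! ### Disjoint members by coupling -/

lemma exists_perm_disjoint {Y : Type*} [Fintype Y] (E : Set Y)
    (hE : 2 * Nat.card E ≤ Nat.card Y) :
    ∃ φ : Equiv.Perm Y, ∀ y ∈ E, φ y ∉ E := by
  classical
  have h1 : (E.toFinset).card ≤ (E.toFinsetᶜ).card := by
    rw [Finset.card_compl, ← Nat.card_eq_card_toFinset, ← Nat.card_eq_fintype_card]
    omega
  obtain ⟨E', hE', hc⟩ := Finset.exists_subset_card_eq h1
  have e : {y // y ∈ E.toFinset} ≃ {y // y ∈ E'} := Finset.equivOfCardEq hc.symm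
  refine ⟨e.extendSubtype, fun y hy => ?_⟩
  have h2 := e.extendSubtype_mem y (by simpa using hy)
  simpa using hE' h2

/-- A sufficiently spread family has two members that are disjoint after permuting one of them. -/
lemma exists_disjoint_of_spread {X ι : Type*} [Fintype X] [DecidableEq X]
    {N κ : ℝ} {R : ℕ} (hR : 0 < R) (hN : 0 < N) (hκ : 32 * (R : ℝ) ≤ κ)
    (Ω : Finset ι) (S : ι → Finset X) (hS : SpreadFamily Ω S N κ) (hΩ : (Ω.card : ℝ) = N)
    (hk : ∀ ω ∈ Ω, (S ω).card < 2 ^ R) (π : Equiv.Perm X) :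
    ∃ ω ∈ Ω, ∃ ω' ∈ Ω, ∀ x ∈ S ω, ∀ y ∈ S ω', x ≠ π y := by
  classical
  have : NeZero (2 * R) := ⟨by omega⟩
  have hR' : (0 : ℝ) < R := by exact_mod_cast hR
  set E : Set (Fin R → Fin (2 * R)) := {y | ∃ j, y j = 0} with hEdef
  -- Union bound: `R` coordinates, each zero with probability `1 / (2 * R)`.
  have hE : 2 * Nat.card E ≤ Nat.card (Fin R → Fin (2 * R)) := by
    have h1 : E.toFinset ⊆ (Finset.univ : Finset (Fin R)).biUnion
        fun j => Finset.univ.filter fun y => y j = 0 := by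
      intro y hy
      simpa [hEdef] using hy
    have h2 := (Finset.card_le_card h1).trans Finset.card_biUnion_le
    have h3 : ∀ j : Fin R, 2 * R * (Finset.univ.filter
        fun y : Fin R → Fin (2 * R) => y j = 0).card = (2 * R) ^ R := by
      intro j
      have h4 := Fintype.card_filter_piFinset_eq_of_mem
        (fun _ : Fin R => (Finset.univ : Finset (Fin (2 * R)))) j (Finset.mem_univ 0)
      simp only [Fintype.piFinset_univ] at h4
      rw [h4]
      simp only [Finset.card_univ, Fintype.card_fin, Finset.prod_const,
        Finset.card_erase_of_mem (Finset.mem_univ j)]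
      rw [mul_comm, ← pow_succ, Nat.sub_add_cancel hR]
    rw [Nat.card_eq_card_toFinset]
    have h5 : R * (2 * E.toFinset.card) ≤ R * (2 * R) ^ R := by
      calc R * (2 * E.toFinset.card) = 2 * R * E.toFinset.card := by ring
        _ ≤ 2 * R * _ := Nat.mul_le_mul_left _ h2
        _ = R * (2 * R) ^ R := by rw [Finset.mul_sum, Finset.sum_congr rfl fun j _ => h3 j]; simp
    simpa using Nat.le_of_mul_le_mul_left h5 hR
  obtain ⟨φ, hφ⟩ := exists_perm_disjoint E hE
  have hκ0 : 0 < κ := by linarith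
  have hmiss := card_misses_le (L := 2 * R) hN.le hκ0 (by push_cast; linarith) R Ω S hS hk
  set B : Finset (Fin R → X → Fin (2 * R)) := Finset.univ.filter fun W => Misses Ω S W with hB
  have hBcard : 3 * B.card ≤ Fintype.card (Fin R → X → Fin (2 * R)) := by
    have h0 : Nat.card {W : Fin R → X → Fin (2 * R) // Misses Ω S W} = B.card := by
      rw [Nat.card_eq_fintype_card, Fintype.card_subtype]
    rw [h0, hΩ, mul_assoc] at hmiss
    have h1 := le_of_mul_le_mul_left hmiss hN
    have h2 : (Fintype.card (Fin R → X → Fin (2 * R)) : ℝ) =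
        (((2 * R : ℕ) : ℝ) ^ Fintype.card X) ^ R := by simp
    have h3 : (0 : ℝ) ≤ (1 / 4) ^ R := by positivity
    have h4 : (0 : ℝ) ≤ (((2 * R : ℕ) : ℝ) ^ Fintype.card X) ^ R := by positivity
    have h5 : (3 * B.card : ℝ) ≤ Fintype.card (Fin R → X → Fin (2 * R)) := by
      rw [h2]
      nlinarith [mul_nonneg h3 h4]
    exact_mod_cast h5
  -- `θ` is injective, hence preserves the uniform measure, and the zero sets of `W` and `θ W` are
  -- disjoint up to `π` by the choice of `φ`.
  let θ : (Fin R → X → Fin (2 * R)) → (Fin R → X → Fin (2 * R)) :=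
    fun W j x => φ (fun j => W j (π x)) j
  have hθ : Function.Injective θ := by
    intro W W' h
    funext j x
    have h1 : φ (fun j => W j (π (π.symm x))) = φ (fun j => W' j (π (π.symm x))) :=
      funext fun j => congrFun (congrFun h j) (π.symm x)
    simpa using congrFun (φ.injective h1) j
  obtain ⟨W, hW⟩ : ∃ W, W ∉ B ∪ B.preimage θ hθ.injOn := by
    by_contra! hall
    have h1 : Finset.univ ⊆ B ∪ B.preimage θ hθ.injOn := fun W _ => hall W
    have h2 := (Finset.card_le_card h1).trans (Finset.card_union_le _ _)
    have h3 : (B.preimage θ hθ.injOn).card ≤ B.card :=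
      Finset.card_le_card_of_injOn θ (fun W hW => by simpa using hW) hθ.injOn
    rw [Finset.card_univ] at h2
    have h4 : 0 < Fintype.card (Fin R → X → Fin (2 * R)) := Fintype.card_pos
    omega
  have hmem : ∀ W, W ∉ B → ∃ ω ∈ Ω, ∀ x ∈ S ω, ∃ j, W j x = 0 := by
    intro W h
    have hW : ¬ Misses Ω S W := fun hm => h (Finset.mem_filter.2 ⟨Finset.mem_univ W, hm⟩)
    simpa [Misses] using hW
  rw [Finset.mem_union, not_or, Finset.mem_preimage] at hW
  obtain ⟨ω, hω, h1⟩ := hmem _ hW.1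
  obtain ⟨ω', hω', h2⟩ := hmem _ hW.2
  refine ⟨ω, hω, ω', hω', fun x hx y hy hxy => ?_⟩
  obtain ⟨j, hj⟩ := h1 x hx
  obtain ⟨j', hj'⟩ := h2 y hy
  exact hφ (fun j => W j (π y)) ⟨j, by rw [← hxy]; exact hj⟩ ⟨j', hj'⟩

/-! ### Value sets over finite fields -/

/-- The points of `V × F` recording the values `x v - f v x`. -/
def valueSet {V F : Type*} [Fintype V] [DecidableEq V] [Field F] [DecidableEq F]
    (f : V → (V → F) →ₗ[F] F) (x : V → F) : Finset (V × F) :=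
  Finset.univ.image fun v => (v, x v - f v x)

lemma mem_valueSet {V F : Type*} [Fintype V] [DecidableEq V] [Field F] [DecidableEq F]
    {f : V → (V → F) →ₗ[F] F} {x : V → F} {z : V × F} :
    z ∈ valueSet f x ↔ x z.1 - f z.1 x = z.2 := by
  obtain ⟨v, a⟩ := z
  simp [valueSet]

/-- If the vertices are divided into `m` parts and each `f v` does not depend on the coordinates
in the part of `v`, the value sets form a spread family. -/
lemma spreadFamily_valueSet {V F : Type*} [Fintype V] [DecidableEq V] [Field F] [Fintype F]
    [DecidableEq F] {m : ℕ} (p : V → Fin m) (f : V → (V → F) →ₗ[F] F)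
    (hf : ∀ v x y, (∀ u, p v ≠ p u → x u = y u) → f v x = f v y) {κ : ℝ} (hκ : 1 ≤ κ)
    (hq : κ ^ m ≤ Fintype.card F) :
    SpreadFamily Finset.univ (valueSet f) ((Fintype.card F : ℝ) ^ Fintype.card V) κ := by
  intro T
  have hκ0 : 0 < κ := by linarith
  set A : Finset (V → F) := Finset.univ.filter fun x => T ⊆ valueSet f x with hA
  have hAmem : ∀ x ∈ A, ∀ z ∈ T, x z.1 - f z.1 x = z.2 := by
    intro x hx z hz
    exact mem_valueSet.1 ((Finset.mem_filter.1 hx).2 hz)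
  rcases A.eq_empty_or_nonempty with h0 | ⟨x₀, hx₀⟩
  · rw [h0]
    simp only [Finset.card_empty, Nat.cast_zero]
    positivity
  have hinj : Set.InjOn (Prod.fst : V × F → V) T := by
    intro z hz z' hz' h
    have h1 := hAmem x₀ hx₀ z hz
    have h2 := hAmem x₀ hx₀ z' hz'
    rw [h] at h1
    exact Prod.ext h (h1.symm.trans h2)
  -- Pigeonhole: `J` lies over the most popular part.
  obtain ⟨J, hJT, hJp, hJ⟩ : ∃ J ⊆ T, (∀ z ∈ J, ∀ z' ∈ J, p z.1 = p z'.1) ∧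
      T.card ≤ m * J.card := by
    rcases T.eq_empty_or_nonempty with rfl | ⟨z, _⟩
    · exact ⟨∅, by simp⟩
    obtain ⟨i, -, hi⟩ := Finset.exists_max_image (Finset.univ : Finset (Fin m))
      (fun i => (T.filter fun z => p z.1 = i).card) ⟨p z.1, Finset.mem_univ _⟩
    refine ⟨T.filter fun z => p z.1 = i, Finset.filter_subset _ _, ?_, ?_⟩
    · intro z hz z' hz'
      rw [(Finset.mem_filter.1 hz).2, (Finset.mem_filter.1 hz').2]
    · have := Finset.card_le_mul_card_image_of_maps_to (s := T) (f := fun z => p z.1)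
        (t := Finset.univ) (fun _ _ => Finset.mem_univ _)
        (T.filter fun z => p z.1 = i).card fun b hb => hi b hb
      rwa [Finset.card_univ, Fintype.card_fin, mul_comm] at this
  set I : Finset V := J.image Prod.fst with hI
  have hIcard : I.card = J.card := Finset.card_image_of_injOn (hinj.mono hJT)
  have hAcard : A.card * Fintype.card F ^ J.card ≤ Fintype.card F ^ Fintype.card V := by
    -- The coordinates outside `I` determine those in `I`, since the forms over one part do not
    -- involve that part.
    have h1 : A.card ≤ (Finset.univ : Finset ({v // v ∉ I} → F)).card := by
      refine Finset.card_le_card_of_injOn (fun x v => x v.1) (fun _ _ => Finset.mem_univ _) ?_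
      intro x hx y hy hxy
      have hout : ∀ v, v ∉ I → x v = y v := fun v hv => congrFun hxy ⟨v, hv⟩
      funext v
      by_cases hv : v ∈ I
      · obtain ⟨z, hz, rfl⟩ := Finset.mem_image.1 hv
        have h2 : f z.1 x = f z.1 y := by
          refine hf _ _ _ fun u hu => hout u fun huI => ?_
          obtain ⟨z', hz', rfl⟩ := Finset.mem_image.1 huI
          exact hu (hJp z hz z' hz')
        have h3 := hAmem x hx z (hJT hz)
        have h4 := hAmem y hy z (hJT hz)
        rw [h2] at h3
        exact sub_left_injective (h3.trans h4.symm)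
      · exact hout v hv
    rw [Finset.card_univ, Fintype.card_fun, Fintype.card_subtype_compl, Fintype.card_coe,
      hIcard] at h1
    refine (Nat.mul_le_mul_right _ h1).trans ?_
    rw [← pow_add, Nat.sub_add_cancel]
    rw [← hIcard]
    exact Finset.card_le_univ I
  have hpow : κ ^ T.card ≤ (Fintype.card F : ℝ) ^ J.card := by
    calc κ ^ T.card ≤ κ ^ (m * J.card) := pow_le_pow_right₀ hκ hJ
      _ = (κ ^ m) ^ J.card := pow_mul _ _ _
      _ ≤ _ := by gcongr
  rw [inv_pow, ← div_eq_mul_inv, le_div_iff₀ (by positivity)]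
  calc (A.card : ℝ) * κ ^ T.card ≤ A.card * (Fintype.card F : ℝ) ^ J.card := by gcongr
    _ ≤ _ := by exact_mod_cast hAcard

/-- Over a large finite field, affine forms `x v - f v x - b v` as in a multipartite guessing
game have a common non-zero. -/
lemma exists_forall_ne_of_finite {V F : Type*} [Fintype V] [Field F] [Finite F]
    {m R : ℕ} (p : V → Fin m) (f : V → (V → F) →ₗ[F] F)
    (hf : ∀ v x y, (∀ u, p v ≠ p u → x u = y u) → f v x = f v y) (b : V → F) (hR : 0 < R)
    (hV : Fintype.card V < 2 ^ R) (hq : (32 * (R : ℝ)) ^ m ≤ Nat.card F) :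
    ∃ x : V → F, ∀ v, f v x + b v ≠ x v := by
  classical
  have := Fintype.ofFinite F
  rw [Nat.card_eq_fintype_card] at hq
  have hR1 : (1 : ℝ) ≤ R := by exact_mod_cast hR
  let π : Equiv.Perm (V × F) :=
    { toFun := fun z => (z.1, z.2 + b z.1)
      invFun := fun z => (z.1, z.2 - b z.1)
      left_inv := fun z => by simp
      right_inv := fun z => by simp }
  have hF : (0 : ℝ) < Fintype.card F := by exact_mod_cast Fintype.card_pos
  obtain ⟨x, -, y, -, h⟩ := exists_disjoint_of_spread hR
    (pow_pos hF (Fintype.card V)) le_rfl Finset.univ (valueSet f)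
    (spreadFamily_valueSet p f hf (by linarith) hq) (by simp)
    (fun x _ => Finset.card_image_le.trans_lt (by simpa using hV)) π
  refine ⟨x - y, fun v hv => ?_⟩
  refine h (v, x v - f v x) (mem_valueSet.2 rfl) (v, y v - f v y) (mem_valueSet.2 rfl) ?_
  simp only [π, Equiv.coe_fn_mk, Prod.mk.injEq, true_and]
  rw [map_sub, Pi.sub_apply] at hv
  linear_combination -hv

/-! ### Infinite fields -/

/-- Over an infinite field, finitely many affine forms `x v - f v x - b v`, where `f v` does not
depend on the coordinate `v`, have a common non-zero. -/
lemma exists_forall_ne_of_infinite {V F : Type*} [Fintype V] [Field F] [Infinite F]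
    (f : V → (V → F) →ₗ[F] F)
    (hf : ∀ v x y, (∀ u, v ≠ u → x u = y u) → f v x = f v y) (b : V → F) :
    ∃ x : V → F, ∀ v, f v x + b v ≠ x v := by
  classical
  suffices h : ∀ s : Finset V, ∃ x : V → F, ∀ v ∈ s, f v x + b v ≠ x v by
    obtain ⟨x, hx⟩ := h Finset.univ
    exact ⟨x, fun v => hx v (Finset.mem_univ v)⟩
  intro s
  induction s using Finset.induction_on with
  | empty => exact ⟨0, by simp⟩
  | insert v s _ ih =>
    obtain ⟨x, hx⟩ := ih
    set e : V → F := Pi.single v 1 with he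
    have hfe : f v e = 0 := by
      rw [hf v e 0 fun u hu => by simp [he, Ne.symm hu], map_zero]
    -- On the line `x + t • e` a nonconstant form excludes one `t`; a constant one stays nonzero,
    -- and its quotient by 0 is harmless.
    obtain ⟨t, ht⟩ := Infinite.exists_notMem_finset
      ((insert v s).image fun u => (x u - f u x - b u) / (f u e - e u))
    refine ⟨x + t • e, fun u hu huz => ?_⟩
    simp only [map_add, map_smul, smul_eq_mul, Pi.add_apply, Pi.smul_apply] at huz
    have hlin : t * (f u e - e u) = x u - f u x - b u := by linear_combination huz
    by_cases h0 : f u e - e u = 0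
    · rcases Finset.mem_insert.1 hu with rfl | hus
      · rw [hfe] at h0
        simp [he] at h0
      · rw [h0, mul_zero] at hlin
        exact hx u hus (by linear_combination hlin)
    · exact ht (Finset.mem_image.2 ⟨u, hu, by rw [← hlin, mul_div_cancel_right₀ _ h0]⟩)

/-! ### Linear strategies and the final bound -/

lemma HatStrategy.IsLinear.exists_linear {V F : Type*} [Field F] {G : SimpleGraph V}
    {S : HatStrategy G F} (hS : S.IsLinear) :
    ∃ (f : V → (V → F) →ₗ[F] F) (b : V → F),
      (∀ v x y, (∀ u, G.Adj v u → x u = y u) → f v x = f v y) ∧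
        ∀ v (x : V → F), S v (fun u => x u) = f v x + b v := by
  choose A hA using hS
  refine ⟨fun v => (A v).linear ∘ₗ LinearMap.funLeft F F Subtype.val, fun v => A v 0, ?_, ?_⟩
  · intro v x y h
    simp only [LinearMap.comp_apply]
    congr 1
    funext u
    exact h u u.2
  · intro v x
    rw [hA, (A v).decomp]
    simp [LinearMap.funLeft]
    rfl

/-- For `k ≥ 2` the left side is at most `64 * log k / log 2`, and `64 / log 2 < 100`. -/
lemma natLog_add_one_le {k : ℕ} (hk : 2 ≤ k) :
    32 * ((Nat.log 2 k + 1 : ℕ) : ℝ) ≤ 100 * Real.log k := by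
  have hk0 : (0 : ℝ) < k := by exact_mod_cast (by omega : 0 < k)
  have hl2 := Real.log_two_gt_d9
  have h1 : Real.log 2 ≤ Real.log k := Real.log_le_log (by norm_num) (by exact_mod_cast hk)
  have h2 : (Nat.log 2 k : ℝ) * Real.log 2 ≤ Real.log k := by
    rw [← Real.log_pow]
    refine Real.log_le_log (by positivity) ?_
    exact_mod_cast Nat.pow_log_le_self 2 (by omega)
  push_cast
  have h3 : (0 : ℝ) ≤ Nat.log 2 k := by positivity
  nlinarith

theorem theorem3 :
    ∃ c : ℝ, 0 < c ∧
      ∀ (n m : ℕ), 1 ≤ n → 1 ≤ m →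
        ∀ (F : Type*) [Field F],
          (Infinite F ∨ (c * Real.log ((n : ℝ) * (m : ℝ))) ^ m ≤ (Nat.card F : ℝ)) →
            ¬ ∃ S : HatStrategy (SimpleGraph.completeEquipartiteGraph m n) F,
                S.IsLinear ∧ S.IsWinning := by
  refine ⟨100, by norm_num, ?_⟩
  rintro n m hn hm F _ hF ⟨S, hS, hwin⟩
  obtain ⟨f, b, hf, hSf⟩ := hS.exists_linear
  suffices h : ∃ x : Fin m × Fin n → F, ∀ v, f v x + b v ≠ x v by
    obtain ⟨x, hx⟩ := h
    obtain ⟨v, hv⟩ := hwin x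
    exact hx v (by rw [← hSf, hv])
  have hf' : ∀ v x y, (∀ u : Fin m × Fin n, v.1 ≠ u.1 → x u = y u) → f v x = f v y :=
    fun v x y h => hf v x y h
  rcases finite_or_infinite F with hfin | hinf
  · have hq := hF.resolve_left (not_infinite_iff_finite.2 hfin)
    -- For a single vertex the logarithm vanishes and the size hypothesis is empty, but the guess is
    -- constant.
    rcases Nat.lt_or_ge (n * m) 2 with h1 | h2
    · have hn1 : n = 1 := by nlinarith
      have hm1 : m = 1 := by nlinarith
      subst hn1 hm1
      refine ⟨fun v => b v + 1, fun v => ?_⟩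
      rw [hf' v _ 0 fun u hu => absurd (Subsingleton.elim _ _) hu, map_zero]
      simp
    · refine exists_forall_ne_of_finite (R := Nat.log 2 (n * m) + 1) Prod.fst f hf' b
        (Nat.succ_pos _) ?_ ?_
      · simpa [mul_comm] using Nat.lt_pow_succ_log_self (b := 2) (by norm_num) (n * m)
      · refine le_trans ?_ hq
        have h3 := natLog_add_one_le h2
        push_cast at h3 ⊢
        gcongr
  · exact exists_forall_ne_of_infinite f
      (fun v x y h => hf' v x y fun u hu => h u fun huv => hu (by rw [huv])) b
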